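/- Let $D, D'$ be finitely generated abelian groups, $\delta\colon D\to D'$ a group homomorphism, and $S=\bigoplus_{d\in D}S_d$ a $D$-graded commutative ring. Write $S_\delta$ for the ring $S$ with the $D'$-grading $(S_\delta)_{d'}=\bigoplus_{\delta(d)=d'}S_d$. An element $f\in S$ is called relevant (for a given grading) if it is homogeneous and the degrees of the homogeneous units of the localization $S_f$ form a subgroup of finite index in the grading group; put $S_{(f)}=(S_f)_0$. The multihomogeneous spectrum $\mathrm{Proj}(S)$ is the scheme obtained by gluing the affine schemes $D_+(f)=\mathrm{Spec}\,S_{(f)}$, for $f$ relevant, along the open subschemes $\mathrm{Spec}\,S_{(fg)}$; it comes with a morphism $\mathrm{Proj}(S)\to\mathrm{Spec}(S_0)$ given on charts by $S_0\to S_{(f)}$. The same applies to $S_\delta$. Let $U\subseteq \mathrm{Proj}(S_\delta)$ be the open subscheme $U=\bigcup_f \mathrm{Spec}\,(S_\delta)_{(f)}$, where $f$ runs through the elements of $S$ that are relevant both for $S$ and for $S_\delta$. Then there is a natural rational map $\varphi\colon \mathrm{Proj}(S_\delta)\dashrightarrow \mathrm{Proj}(S)$ defined on $U$: there is a unique morphism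 of schemes $\varphi\colon U\to\mathrm{Proj}(S)$ whose restriction to $\mathrm{Spec}\,(S_\delta)_{(f)}$ is, for each such $f$, the composition $$\mathrm{Spec}\,(S_\delta)_{(f)}\longrightarrow \mathrm{Spec}\,S_{(f)}= D_+(f)\subseteq\mathrm{Proj}(S)$$ induced by the inclusion $S_{(f)}\subseteq (S_\delta)_{(f)}$. It is compatible with the maps to the spectra of the degree-zero parts: the composition $U\to\mathrm{Proj}(S)\to\mathrm{Spec}(S_0)$ equals the composition $U\subseteq\mathrm{Proj}(S_\delta)\to\mathrm{Spec}((S_\delta)_0)\to\mathrm{Spec}(S_0)$, the last map being induced by $S_0\subseteq (S_\delta)_0$. (Here a rational map is a morphism on a specified open subscheme, which in general need not be dense. The open subscheme $U$ is dense in $\mathrm{Proj}(S_\delta)$ if and only if for every non-nilpotent $S_\delta$-relevant $g$ there is an $f$ relevant for both $S$ and $S_\delta$ such that $fg$ is not nilpotent.) -/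

import Mathlib

universe u v w

namespace MultiProj

open CategoryTheory CategoryTheory.Limits AlgebraicGeometry

noncomputable section

section Definitions

variable {D : Type v} [AddCommGroup D] {S : Type u} [CommRing S]

/-- For a `D`-graded ring `ℬ`, being periodic: the degrees of the homogeneous units form a
subgroup of finite index in `D`. -/
def IsPeriodic (ℬ : D → AddSubgroup S) : Prop :=
  (AddSubgroup.closure {d : D | ∃ u ∈ ℬ d, IsUnit u}).FiniteIndex

variable [DecidableEq D] (𝒜 : D → AddSubgroup S) [GradedRing 𝒜]

/-- The grading of the localization `S_f`: the elements of degree `d` are the fractions `a / f ^ n`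
with `f ^ n` of some degree `e` and `a` of degree `d + e`. -/
def awayGrading (f : S) (d : D) : AddSubgroup (Localization.Away f) where
  carrier := {x | ∃ (n : ℕ) (e : D) (a : S), f ^ n ∈ 𝒜 e ∧ a ∈ 𝒜 (d + e) ∧
    x * algebraMap S (Localization.Away f) (f ^ n) = algebraMap S (Localization.Away f) a}
  zero_mem' := ⟨0, 0, 0, by simpa using SetLike.GradedOne.one_mem, zero_mem _, by simp⟩
  add_mem' := by
    rintro x y ⟨n, e, a, hn, ha, hx⟩ ⟨m, i, b, hm, hb, hy⟩
    refine ⟨n + m, e + i, a * f ^ m + b * f ^ n, ?_, ?_, ?_⟩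
    · rw [pow_add]; exact SetLike.mul_mem_graded hn hm
    · refine add_mem ?_ ?_
      · have := SetLike.mul_mem_graded ha hm
        rwa [add_assoc] at this
      · have := SetLike.mul_mem_graded hb hn
        rwa [add_assoc, add_comm i e] at this
    · simp only [pow_add, map_mul, map_add, ← hx, ← hy]; ring
  neg_mem' := by
    rintro x ⟨n, e, a, hn, ha, hx⟩
    exact ⟨n, e, -a, hn, neg_mem ha, by simp [← hx]⟩

instance (f : S) : SetLike.GradedMonoid (awayGrading 𝒜 f) where
  one_mem := ⟨0, 0, 1, by simpa using SetLike.GradedOne.one_mem,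
    by simpa using SetLike.GradedOne.one_mem, by simp⟩
  mul_mem := by
    rintro d d' x y ⟨n, e, a, hn, ha, hx⟩ ⟨m, i, b, hm, hb, hy⟩
    refine ⟨n + m, e + i, a * b, ?_, ?_, ?_⟩
    · rw [pow_add]; exact SetLike.mul_mem_graded hn hm
    · have := SetLike.mul_mem_graded ha hb
      rwa [add_add_add_comm] at this
    · simp only [pow_add, map_mul, ← hx, ← hy]; ring

/-- An element `f` is relevant if it is homogeneous and the localization `S_f` is periodic. -/
structure IsRelevant (f : S) : Prop where
  isHomogeneous : SetLike.IsHomogeneousElem 𝒜 f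
  isPeriodic : IsPeriodic (awayGrading 𝒜 f)

/-- The ring `S_(f) = (S_f)_0`. -/
abbrev AwayZero (f : S) : Type u := awayGrading 𝒜 f 0

end Definitions

section Algebra

variable {D : Type v} [AddCommGroup D] {S : Type u} [CommRing S]
variable [DecidableEq D] (𝒜 : D → AddSubgroup S) [GradedRing 𝒜]

variable {𝒜} in
lemma exists_homogeneous_mul_eq {a b c : S} {i j : D} (ha : a ∈ 𝒜 i) (hc : c ∈ 𝒜 j)
    (h : a * b = c) : ∃ b' ∈ 𝒜 (j - i), a * b' = c := by
  refine ⟨DirectSum.decompose 𝒜 b (j - i), SetLike.coe_mem _, ?_⟩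
  have := DirectSum.coe_decompose_mul_add_of_left_mem 𝒜 (j := j - i) (b := b) ha
  rw [← this, h, add_sub_cancel, DirectSum.decompose_of_mem_same 𝒜 hc]

variable {𝒜} in
/-- Normal form of homogeneous fractions when the degree of `f` is given. -/
lemma mem_awayGrading_iff {f : S} {df : D} (hf : f ∈ 𝒜 df) {d : D} {x : Localization.Away f} :
    x ∈ awayGrading 𝒜 f d ↔ ∃ (n : ℕ) (a : S), a ∈ 𝒜 (d + n • df) ∧
      x * algebraMap S (Localization.Away f) f ^ n = algebraMap S (Localization.Away f) a := by
  constructor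
  · rintro ⟨n, e, a, hn, ha, hx⟩
    by_cases h0 : f ^ n = 0
    · exact ⟨n, 0, zero_mem _, by rw [← map_pow, h0]; simp⟩
    · have : e = n • df :=
        DirectSum.degree_eq_of_mem_mem 𝒜 hn (SetLike.pow_mem_graded n hf) h0
      subst this
      exact ⟨n, a, ha, by rw [← map_pow, hx]⟩
  · rintro ⟨n, a, ha, hx⟩
    exact ⟨n, n • df, a, SetLike.pow_mem_graded n hf, ha, by rw [map_pow, hx]⟩

lemma algebraMap_mem_awayGrading (f : S) {a : S} {d : D} (ha : a ∈ 𝒜 d) :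
    algebraMap S (Localization.Away f) a ∈ awayGrading 𝒜 f d :=
  ⟨0, 0, a, by simpa using SetLike.GradedOne.one_mem, by simpa using ha, by simp⟩

variable {𝒜} in
/-- The inverse of a homogeneous unit of `S_f` is homogeneous. -/
lemma inv_mem_awayGrading {f : S} {df : D} (hf : f ∈ 𝒜 df) {d : D} {u v : Localization.Away f}
    (hu : u ∈ awayGrading 𝒜 f d) (huv : u * v = 1) : v ∈ awayGrading 𝒜 f (-d) := by
  obtain ⟨n, a, ha, hx⟩ := (mem_awayGrading_iff hf).mp hu
  obtain ⟨m, b, hb⟩ := IsLocalization.Away.surj f v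
  obtain ⟨k, hk⟩ : ∃ k : ℕ, f ^ k * (a * b) = f ^ k * f ^ (n + m) := by
    apply IsLocalization.Away.exists_of_eq f (S := Localization.Away f)
    rw [map_mul, ← hx, ← hb, map_pow]
    linear_combination (algebraMap S (Localization.Away f) f ^ (n + m)) * huv
  have h1 : (f ^ k * a) * b = f ^ (k + (n + m)) := by rw [pow_add, ← hk]; ring
  obtain ⟨b', hb', hab⟩ := exists_homogeneous_mul_eq
    (SetLike.mul_mem_graded (SetLike.pow_mem_graded k hf) ha)
    (SetLike.pow_mem_graded (k + (n + m)) hf) h1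
  refine (mem_awayGrading_iff hf).mpr ⟨m, b', ?_, ?_⟩
  · convert hb' using 2
    simp only [add_smul]; abel
  · have hF : IsUnit (algebraMap S (Localization.Away f) f) :=
      IsLocalization.Away.algebraMap_isUnit f
    have h2 := congrArg (algebraMap S (Localization.Away f)) hab
    simp only [map_mul, map_pow, ← hx] at h2
    have h3 : algebraMap S (Localization.Away f) f ^ (k + n) *
        (v * algebraMap S (Localization.Away f) f ^ m) =
        algebraMap S (Localization.Away f) f ^ (k + n) * algebraMap S (Localization.Away f) b' := by
      have h4 : algebraMap S (Localization.Away f) f ^ (k + n) =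
        (algebraMap S (Localization.Away f) f ^ (k + n) * u) * v := by
        rw [mul_assoc, huv, mul_one]
      linear_combination (-v) * h2 + (algebraMap S (Localization.Away f) f ^ (k + n)) *
        (algebraMap S (Localization.Away f) b') * huv
    exact (hF.pow (k + n)).mul_left_cancel h3

variable {𝒜} in
/-- In a periodic `S_f`, every degree has a positive multiple that is the degree of a unit. -/
lemma IsRelevant.exists_unit {f : S} (hf : IsRelevant 𝒜 f) (d : D) :
    ∃ n : ℕ, 0 < n ∧ ∃ u v : Localization.Away f,
      u ∈ awayGrading 𝒜 f (n • d) ∧ v ∈ awayGrading 𝒜 f (-(n • d)) ∧ u * v = 1 := by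
  obtain ⟨⟨df, hdf⟩, hper⟩ := hf
  have key : ∀ x ∈ AddSubgroup.closure {d : D | ∃ u ∈ awayGrading 𝒜 f d, IsUnit u},
      ∃ u v : Localization.Away f, u ∈ awayGrading 𝒜 f x ∧ v ∈ awayGrading 𝒜 f (-x) ∧
        u * v = 1 := by
    intro x hx
    induction hx using AddSubgroup.closure_induction with
    | mem x hx =>
      obtain ⟨u, hu, hu'⟩ := hx
      obtain ⟨v, hv⟩ := hu'.exists_right_inv
      exact ⟨u, v, hu, inv_mem_awayGrading hdf hu hv, hv⟩
    | zero => exact ⟨1, 1, SetLike.GradedOne.one_mem,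
        by simpa using SetLike.GradedOne.one_mem, by simp⟩
    | add x y _ _ hx hy =>
      obtain ⟨u, v, hu, hv, h⟩ := hx
      obtain ⟨u', v', hu', hv', h'⟩ := hy
      refine ⟨u * u', v * v', SetLike.mul_mem_graded hu hu', ?_, ?_⟩
      · rw [neg_add]; exact SetLike.mul_mem_graded hv hv'
      · rw [mul_mul_mul_comm, h, h', one_mul]
    | neg x _ hx =>
      obtain ⟨u, v, hu, hv, h⟩ := hx
      exact ⟨v, u, hv, by simpa using hu, by rw [mul_comm, h]⟩
  obtain ⟨n, hn, -, hmem⟩ := AddSubgroup.exists_nsmul_mem_of_index_ne_zero hper.index_ne_zero d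
  exact ⟨n, hn, key _ hmem⟩

/-- The canonical map `S_g → S_f` when `g` divides a power of `f`. -/
def locMap {f g : S} (h : ∃ n : ℕ, g ∣ f ^ n) : Localization.Away g →+* Localization.Away f :=
  IsLocalization.Away.lift g (g := algebraMap S (Localization.Away f))
    ((IsLocalization.Away.algebraMap_isUnit_iff (x := f)).mpr h)

@[simp]
lemma locMap_algebraMap {f g : S} (h : ∃ n : ℕ, g ∣ f ^ n) (a : S) :
    locMap h (algebraMap S (Localization.Away g) a) = algebraMap S (Localization.Away f) a :=
  IsLocalization.Away.lift_eq _ _ _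

lemma locMap_hom_ext {f g : S} {φ ψ : Localization.Away g →+* Localization.Away f}
    (h : φ.comp (algebraMap S _) = ψ.comp (algebraMap S _)) : φ = ψ :=
  IsLocalization.ringHom_ext (Submonoid.powers g) h

lemma locMap_refl {f : S} (h : ∃ n : ℕ, f ∣ f ^ n) (x : Localization.Away f) :
    locMap h x = x := by
  have : locMap h = RingHom.id _ := locMap_hom_ext (by ext; simp)
  simp [this]

lemma locMap_locMap {f g k : S} (h : ∃ n : ℕ, g ∣ f ^ n) (h' : ∃ n : ℕ, k ∣ g ^ n)
    (h'' : ∃ n : ℕ, k ∣ f ^ n) (x : Localization.Away k) :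
    locMap h (locMap h' x) = locMap h'' x := by
  have : (locMap h).comp (locMap h') = locMap h'' :=
    IsLocalization.ringHom_ext (Submonoid.powers k) (by ext; simp)
  rw [← this]; rfl

variable {𝒜} in
lemma locMap_mem {f g : S} (hf : SetLike.IsHomogeneousElem 𝒜 f)
    (hg : SetLike.IsHomogeneousElem 𝒜 g) (h : ∃ n : ℕ, g ∣ f ^ n) {d : D}
    {x : Localization.Away g} (hx : x ∈ awayGrading 𝒜 g d) :
    locMap h x ∈ awayGrading 𝒜 f d := by
  obtain ⟨df, hdf⟩ := hf
  obtain ⟨dg, hdg⟩ := hg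
  obtain ⟨n, a, ha, hxa⟩ := (mem_awayGrading_iff hdg).mp hx
  obtain ⟨m, c, hc⟩ := id h
  obtain ⟨c', hc', hgc⟩ := exists_homogeneous_mul_eq hdg (SetLike.pow_mem_graded m hdf) hc.symm
  refine (mem_awayGrading_iff hdf).mpr ⟨m * n, a * c' ^ n, ?_, ?_⟩
  · have := SetLike.mul_mem_graded ha (SetLike.pow_mem_graded n hc')
    convert this using 2
    simp only [smul_sub, mul_comm m n, mul_smul]; abel
  · have h1 := congrArg (locMap h) hxa
    simp only [map_mul, map_pow, locMap_algebraMap] at h1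
    rw [pow_mul, ← map_pow _ f m, ← hgc]
    simp only [map_mul, map_pow, ← h1]; ring

variable {𝒜} in
lemma IsRelevant.mul {f g : S} (hf : IsRelevant 𝒜 f) (hg : IsRelevant 𝒜 g) :
    IsRelevant 𝒜 (f * g) := by
  obtain ⟨⟨df, hdf⟩, hper⟩ := hf
  obtain ⟨⟨dg, hdg⟩, -⟩ := hg
  have hfg : SetLike.IsHomogeneousElem 𝒜 (f * g) := ⟨df + dg, SetLike.mul_mem_graded hdf hdg⟩
  refine ⟨hfg, ?_⟩
  have h : ∃ n : ℕ, f ∣ (f * g) ^ n := ⟨1, by simp⟩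
  have : (AddSubgroup.closure {d : D | ∃ u ∈ awayGrading 𝒜 f d, IsUnit u}).FiniteIndex := hper
  refine AddSubgroup.finiteIndex_of_le (H := AddSubgroup.closure
    {d : D | ∃ u ∈ awayGrading 𝒜 f d, IsUnit u}) (AddSubgroup.closure_mono ?_)
  rintro d ⟨u, hu, hu'⟩
  exact ⟨locMap h u, locMap_mem hfg ⟨df, hdf⟩ h hu, hu'.map _⟩

/-- The canonical map `S_(g) → S_(f)` when `g` divides a power of `f`. -/
def awayZeroMap {f g : S} (hf : SetLike.IsHomogeneousElem 𝒜 f)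
    (hg : SetLike.IsHomogeneousElem 𝒜 g) (h : ∃ n : ℕ, g ∣ f ^ n) :
    AwayZero 𝒜 g →+* AwayZero 𝒜 f where
  toFun x := ⟨locMap h x, locMap_mem hf hg h x.2⟩
  map_one' := Subtype.ext (map_one (locMap h))
  map_zero' := Subtype.ext (map_zero (locMap h))
  map_mul' x y := Subtype.ext (map_mul (locMap h) x.1 y.1)
  map_add' x y := Subtype.ext (map_add (locMap h) x.1 y.1)

@[simp]
lemma coe_awayZeroMap {f g : S} (hf : SetLike.IsHomogeneousElem 𝒜 f)
    (hg : SetLike.IsHomogeneousElem 𝒜 g) (h : ∃ n : ℕ, g ∣ f ^ n) (x : AwayZero 𝒜 g) :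
    (awayZeroMap 𝒜 hf hg h x : Localization.Away f) = locMap h x := rfl

/-- The canonical map `S_0 → S_(f)`. -/
def zeroToAwayZero (f : S) : 𝒜 0 →+* AwayZero 𝒜 f where
  toFun a := ⟨algebraMap S (Localization.Away f) a, algebraMap_mem_awayGrading 𝒜 f a.2⟩
  map_one' := Subtype.ext (map_one (algebraMap S (Localization.Away f)))
  map_zero' := Subtype.ext (map_zero (algebraMap S (Localization.Away f)))
  map_mul' x y := Subtype.ext (map_mul (algebraMap S (Localization.Away f)) x.1 y.1)
  map_add' x y := Subtype.ext (map_add (algebraMap S (Localization.Away f)) x.1 y.1)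

/-- If `f` and `g * s` divide powers of each other, and `u` is a unit of `S_g` whose degree is a
positive multiple `n` of the degree of `s`, then `S_(f)` is the localization of `S_(g)` at the
element `s ^ n / u`. -/
lemma isLocalization_awayZeroMap {f g s : S} {df dg ds : D} (hf : f ∈ 𝒜 df) (hg : g ∈ 𝒜 dg)
    (hs : s ∈ 𝒜 ds) (hgf : ∃ n : ℕ, g ∣ f ^ n) (hsf : ∃ n : ℕ, s ∣ f ^ n)
    (hfgs : ∃ n : ℕ, f ∣ (g * s) ^ n) {n : ℕ} (hn : 0 < n) {u v : Localization.Away g}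
    (hu : u ∈ awayGrading 𝒜 g (n • ds)) (hv : v ∈ awayGrading 𝒜 g (-(n • ds))) (huv : u * v = 1)
    (r : AwayZero 𝒜 g) (hr : (r : Localization.Away g) = algebraMap S _ s ^ n * v) :
    @IsLocalization.Away _ _ r (AwayZero 𝒜 f) _ (awayZeroMap 𝒜 ⟨df, hf⟩ ⟨dg, hg⟩ hgf).toAlgebra := by
  let _ := (awayZeroMap 𝒜 ⟨df, hf⟩ ⟨dg, hg⟩ hgf).toAlgebra
  have halg (x : AwayZero 𝒜 g) : ((algebraMap (AwayZero 𝒜 g) (AwayZero 𝒜 f) x : AwayZero 𝒜 f) :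
    Localization.Away f) = locMap hgf x := rfl
  have hsu : IsUnit (algebraMap S (Localization.Away f) s) :=
    (IsLocalization.Away.algebraMap_isUnit_iff (x := f)).mpr hsf
  have hgu : IsUnit (algebraMap S (Localization.Away g) g) :=
    IsLocalization.Away.algebraMap_isUnit g
  obtain ⟨t, ht⟩ := hsu.exists_right_inv
  have htm : t ∈ awayGrading 𝒜 f (-ds) :=
    inv_mem_awayGrading hf (algebraMap_mem_awayGrading 𝒜 f hs) ht
  have huv' : locMap hgf u * locMap hgf v = 1 := by rw [← map_mul, huv, map_one]
  have hr' : locMap hgf (r : Localization.Away g) =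
      algebraMap S (Localization.Away f) s ^ n * locMap hgf v := by
    rw [hr, map_mul, map_pow, locMap_algebraMap]
  -- the inverse of the image of `r`
  have hrinv : ∃ y : AwayZero 𝒜 f, algebraMap (AwayZero 𝒜 g) (AwayZero 𝒜 f) r * y = 1 := by
    refine ⟨⟨t ^ n * locMap hgf u, ?_⟩, ?_⟩
    · have := SetLike.mul_mem_graded (SetLike.pow_mem_graded n htm)
        (locMap_mem ⟨df, hf⟩ ⟨dg, hg⟩ hgf hu)
      convert this using 2
      simp
    · apply Subtype.ext
      change locMap hgf (r : Localization.Away g) * (t ^ n * locMap hgf u) = 1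
      rw [hr']
      calc _ = (algebraMap S (Localization.Away f) s * t) ^ n * (locMap hgf u * locMap hgf v) := by
            ring
        _ = 1 := by rw [ht, huv']; simp
  obtain ⟨k, c₀, hc₀⟩ := hfgs
  obtain ⟨c, hc, hfc⟩ := exists_homogeneous_mul_eq hf
    (SetLike.pow_mem_graded k (SetLike.mul_mem_graded hg hs)) hc₀.symm
  obtain ⟨n, rfl⟩ : ∃ n', n = n' + 1 := ⟨n - 1, by omega⟩
  refine IsLocalization.Away.mk r ?_ ?_ ?_
  · obtain ⟨y, hy⟩ := hrinv
    exact IsUnit.of_mul_eq_one y hy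
  · intro y
    obtain ⟨m, a, ha, hya⟩ := (mem_awayGrading_iff hf).mp y.2
    obtain ⟨gi, hgi⟩ := hgu.exists_right_inv
    have hgim : gi ∈ awayGrading 𝒜 g (-dg) :=
      inv_mem_awayGrading hg (algebraMap_mem_awayGrading 𝒜 g hg) hgi
    have hgi' : algebraMap S (Localization.Away f) g * locMap hgf gi = 1 := by
      rw [← locMap_algebraMap hgf, ← map_mul, hgi, map_one]
    refine ⟨k * m, ⟨gi ^ (k * m) * (algebraMap S _ (a * c ^ m * s ^ (n * (k * m))) *
      v ^ (k * m)), ?_⟩, ?_⟩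
    · have := SetLike.mul_mem_graded (SetLike.pow_mem_graded (k * m) hgim)
        (SetLike.mul_mem_graded (algebraMap_mem_awayGrading 𝒜 g (SetLike.mul_mem_graded
          (SetLike.mul_mem_graded ha (SetLike.pow_mem_graded m hc))
          (SetLike.pow_mem_graded (n * (k * m)) hs))) (SetLike.pow_mem_graded (k * m) hv))
      convert this using 2
      simp only [smul_sub, smul_add, smul_neg, zero_add, add_smul, one_smul, mul_smul,
        smul_comm n k, smul_comm n m, smul_comm m k]
      abel
    · apply Subtype.ext
      change (y : Localization.Away f) * locMap hgf (r : Localization.Away g) ^ (k * m) =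
        locMap hgf (gi ^ (k * m) * (algebraMap S _ (a * c ^ m * s ^ (n * (k * m))) * v ^ (k * m)))
      have h1 : algebraMap S (Localization.Away f) f * algebraMap S _ c =
          (algebraMap S _ g * algebraMap S _ s) ^ k := by
        rw [← map_mul, hfc, map_pow, map_mul]
      rw [hr']
      simp only [map_mul, map_pow, locMap_algebraMap]
      rw [← hya]
      calc _ = (y : Localization.Away f) * (algebraMap S (Localization.Away f) s ^ (n + 1) *
            locMap hgf v) ^ (k * m) * 1 ^ (k * m) := by simp
        _ = (y : Localization.Away f) * ((algebraMap S _ g * algebraMap S _ s) ^ k) ^ m *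
            algebraMap S (Localization.Away f) s ^ (n * (k * m)) *
            locMap hgf v ^ (k * m) * locMap hgf gi ^ (k * m) := by
          rw [← hgi']; ring
        _ = _ := by rw [← h1]; ring
  · intro x₁ x₂ hx
    have hx' : locMap hgf (x₁ : Localization.Away g) = locMap hgf (x₂ : Localization.Away g) :=
      congrArg Subtype.val hx
    obtain ⟨l, b, hb⟩ := IsLocalization.Away.surj g ((x₁ : Localization.Away g) - x₂)
    have hb0 : algebraMap S (Localization.Away f) b = algebraMap S (Localization.Away f) 0 := by
      rw [← locMap_algebraMap hgf, ← hb, map_mul, map_sub, hx']; simp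
    obtain ⟨m, hm⟩ := IsLocalization.Away.exists_of_eq f hb0
    have h2 : (g * s) ^ (k * m) * b = 0 := by
      rw [pow_mul, ← hfc, mul_pow, mul_right_comm, hm]; simp
    have h3 := congrArg (algebraMap S (Localization.Away g)) h2
    simp only [map_mul, map_pow, ← hb, map_zero] at h3
    have h4 : algebraMap S (Localization.Away g) g ^ (k * m + l) *
        (algebraMap S (Localization.Away g) s ^ (k * m) * ((x₁ : Localization.Away g) - x₂)) =
        algebraMap S (Localization.Away g) g ^ (k * m + l) * 0 := by
      rw [mul_zero, ← h3]; ring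
    have h5 := (hgu.pow _).mul_left_cancel h4
    refine ⟨k * m, Subtype.ext ?_⟩
    change (r : Localization.Away g) ^ (k * m) * (x₁ : Localization.Away g) =
      (r : Localization.Away g) ^ (k * m) * (x₂ : Localization.Away g)
    rw [hr]
    linear_combination (algebraMap S (Localization.Away g) s ^ (n * (k * m)) * v ^ (k * m)) * h5

end Algebra

section Proj

variable {D : Type v} [AddCommGroup D] {S : Type u} [CommRing S]
variable [DecidableEq D] (𝒜 : D → AddSubgroup S) [GradedRing 𝒜]

/-- The set of relevant elements, indexing the charts of the multihomogeneous spectrum. -/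
structure Rel where
  /-- the underlying element -/
  val : S
  isRelevant : IsRelevant 𝒜 val

/-- `f ≤ g` if `g` divides a power of `f`, that is, if `g` is invertible in `S_f`. -/
instance : Preorder (Rel 𝒜) where
  le f g := ∃ n : ℕ, g.val ∣ f.val ^ n
  le_refl f := ⟨1, by simp⟩
  le_trans f g h := by
    rintro ⟨n, hn⟩ ⟨m, hm⟩
    exact ⟨n * m, hm.trans (by rw [pow_mul]; exact pow_dvd_pow_of_dvd hn m)⟩

/-- The diagram of the affine schemes `Spec S_(f)`, for `f` relevant, with the natural maps
`Spec S_(f) ⟶ Spec S_(g)` whenever `g` divides a power of `f`. -/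
def chartDiagram : Rel 𝒜 ⥤ Scheme.{u} where
  obj f := Spec (.of (AwayZero 𝒜 f.val))
  map {f g} h := Spec.map (CommRingCat.ofHom
    (awayZeroMap 𝒜 f.isRelevant.isHomogeneous g.isRelevant.isHomogeneous (leOfHom h)))
  map_id f := by
    rw [← Spec.map_id]
    congr 1
    ext x
    exact locMap_refl _ _
  map_comp {f g k} h h' := by
    rw [← Spec.map_comp]
    congr 1
    ext x
    exact (locMap_locMap _ _ _ _).symm

lemma chartDiagram_map {f g : Rel 𝒜} (h : f ⟶ g) : (chartDiagram 𝒜).map h =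
    Spec.map (CommRingCat.ofHom (awayZeroMap 𝒜 f.isRelevant.isHomogeneous g.isRelevant.isHomogeneous (leOfHom h))) := rfl

variable {𝒜} in
/-- The product of two relevant elements, as a relevant element. -/
def Rel.mul (f g : Rel 𝒜) : Rel 𝒜 := ⟨f.val * g.val, f.isRelevant.mul g.isRelevant⟩

lemma Rel.mul_le_left (f g : Rel 𝒜) : f.mul g ≤ f := ⟨1, by simp [Rel.mul]⟩

lemma Rel.mul_le_right (f g : Rel 𝒜) : f.mul g ≤ g := ⟨1, by simp [Rel.mul]⟩

lemma Rel.exists_isLocalization (k s : Rel 𝒜) : ∃ r : AwayZero 𝒜 k.val,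
    ∀ (g f : Rel 𝒜) (hgk : g ≤ k) (hfg : f ≤ g) (_ : f ≤ s) (_ : ∃ n, f.val ∣ (g.val * s.val) ^ n),
      @IsLocalization.Away _ _ (awayZeroMap 𝒜 g.isRelevant.isHomogeneous k.isRelevant.isHomogeneous hgk r)
        (AwayZero 𝒜 f.val) _ (awayZeroMap 𝒜 f.isRelevant.isHomogeneous g.isRelevant.isHomogeneous hfg).toAlgebra := by
  obtain ⟨⟨ds, hds⟩, -⟩ := id s.isRelevant
  obtain ⟨n, hn, u, v, hu, hv, huv⟩ := k.isRelevant.exists_unit ds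
  refine ⟨⟨algebraMap S _ s.val ^ n * v, ?_⟩, ?_⟩
  · have := SetLike.mul_mem_graded (SetLike.pow_mem_graded n
      (algebraMap_mem_awayGrading 𝒜 k.val hds)) hv
    convert this using 2
    simp
  · intro g f hgk hfg hfs h
    obtain ⟨⟨df, hdf⟩, -⟩ := id f.isRelevant
    obtain ⟨⟨dg, hdg⟩, -⟩ := id g.isRelevant
    refine isLocalization_awayZeroMap 𝒜 hdf hdg hds hfg hfs h hn
      (locMap_mem g.isRelevant.isHomogeneous k.isRelevant.isHomogeneous hgk hu)
      (locMap_mem g.isRelevant.isHomogeneous k.isRelevant.isHomogeneous hgk hv) (by rw [← map_mul, huv, map_one]) _ ?_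
    simp

instance {f g : Rel 𝒜} (h : f ⟶ g) : IsOpenImmersion ((chartDiagram 𝒜).map h) := by
  obtain ⟨r, hr⟩ := Rel.exists_isLocalization 𝒜 g f
  let _ := (awayZeroMap 𝒜 f.isRelevant.isHomogeneous g.isRelevant.isHomogeneous (leOfHom h)).toAlgebra
  have := hr g f le_rfl (leOfHom h) le_rfl ⟨1, by simp⟩
  exact IsOpenImmersion.of_isLocalization (awayZeroMap 𝒜 g.isRelevant.isHomogeneous g.isRelevant.isHomogeneous (le_refl g) r)

instance : (chartDiagram 𝒜 ⋙ Scheme.forget).IsLocallyDirected where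
  cond := by
    intro f g k hfk hgk x y hxy
    change (chartDiagram 𝒜).map hfk x = (chartDiagram 𝒜).map hgk y at hxy
    obtain ⟨r, hr⟩ := Rel.exists_isLocalization 𝒜 k g
    let hf : f.mul g ⟶ f := homOfLE (Rel.mul_le_left 𝒜 f g)
    let hg : f.mul g ⟶ g := homOfLE (Rel.mul_le_right 𝒜 f g)
    let _ := (awayZeroMap 𝒜 (f.mul g).isRelevant.isHomogeneous f.isRelevant.isHomogeneous
      (leOfHom hf)).toAlgebra
    let _ := (awayZeroMap 𝒜 g.isRelevant.isHomogeneous k.isRelevant.isHomogeneous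
      (leOfHom hgk)).toAlgebra
    have loc₁ := hr f (f.mul g) (leOfHom hfk) (leOfHom hf) (leOfHom hg) ⟨1, by simp [Rel.mul]⟩
    have loc₂ := hr k g le_rfl (leOfHom hgk) le_rfl ⟨1, by simp⟩
    have hrk : awayZeroMap 𝒜 k.isRelevant.isHomogeneous k.isRelevant.isHomogeneous
        (le_refl k) r = r := Subtype.ext (locMap_refl _ _)
    rw [hrk] at loc₂
    have hmem : ((chartDiagram 𝒜).map hgk y) ∈ PrimeSpectrum.basicOpen r := by
      have := PrimeSpectrum.localization_away_comap_range (AwayZero 𝒜 g.val) r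
      exact this.le ⟨y, rfl⟩
    rw [← hxy] at hmem
    have hmem' : x ∈ PrimeSpectrum.basicOpen (awayZeroMap 𝒜 f.isRelevant.isHomogeneous
      k.isRelevant.isHomogeneous (leOfHom hfk) r) := hmem
    obtain ⟨z, hzx⟩ : ∃ z : (chartDiagram 𝒜).obj (f.mul g), (chartDiagram 𝒜).map hf z = x :=
      (PrimeSpectrum.localization_away_comap_range (AwayZero 𝒜 (f.mul g).val) _).ge hmem'
    refine ⟨f.mul g, hf, hg, z, hzx, ?_⟩
    apply ((chartDiagram 𝒜).map hgk).isOpenEmbedding.injective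
    refine Eq.trans ?_ hxy
    rw [← hzx]
    change ((chartDiagram 𝒜).map hg ≫ (chartDiagram 𝒜).map hgk) z =
      ((chartDiagram 𝒜).map hf ≫ (chartDiagram 𝒜).map hfk) z
    rw [← Functor.map_comp, ← Functor.map_comp]
    rfl

/-- The multihomogeneous spectrum `Proj S` of the `D`-graded ring `S = ⨁ 𝒜 d`: the affine schemes
`Spec S_(f)`, for `f` relevant, glued along the open subschemes `Spec S_(fg)` of `Spec S_(f)` and
`Spec S_(g)`. -/
def multiProj : Scheme.{u} := colimit (chartDiagram 𝒜)

/-- The chart `D_+(f) = Spec S_(f) ⟶ Proj S`. -/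
def chart (f : S) (hf : IsRelevant 𝒜 f) : Spec (.of (AwayZero 𝒜 f)) ⟶ multiProj 𝒜 :=
  colimit.ι (chartDiagram 𝒜) ⟨f, hf⟩

instance (f : S) (hf : IsRelevant 𝒜 f) : IsOpenImmersion (chart 𝒜 f hf) :=
  inferInstanceAs (IsOpenImmersion (colimit.ι (chartDiagram 𝒜) ⟨f, hf⟩))

/-- The structure morphism `Proj S ⟶ Spec S_0`, given on each chart by `S_0 → S_(f)`. -/
def toSpecZero : multiProj 𝒜 ⟶ Spec (.of (𝒜 0)) :=
  colimit.desc (chartDiagram 𝒜)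
    { pt := Spec (.of (𝒜 0))
      ι :=
        { app f := Spec.map (CommRingCat.ofHom (zeroToAwayZero 𝒜 f.val))
          naturality f g h := by
            rw [chartDiagram_map]
            refine Eq.trans ?_ (Category.comp_id _).symm
            refine (Spec.map_comp _ _).symm.trans ?_
            congr 1
            ext x
            exact locMap_algebraMap _ _ } }

lemma chart_toSpecZero (f : S) (hf : IsRelevant 𝒜 f) :
    chart 𝒜 f hf ≫ toSpecZero 𝒜 = Spec.map (CommRingCat.ofHom (zeroToAwayZero 𝒜 f)) :=
  colimit.ι_desc _ _

end Proj

section Regrade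

variable {D : Type v} [AddCommGroup D] {D' : Type w} [AddCommGroup D'] {S : Type u} [CommRing S]
variable (𝒜 : D → AddSubgroup S) (δ : D →+ D')

/-- The regrading `S_δ` along `δ : D → D'`: its part of degree `d'` is the sum of the `𝒜 d` with
`δ d = d'`. -/
def regrade (d' : D') : AddSubgroup S := ⨆ d : {d : D // δ d = d'}, 𝒜 d

lemma le_regrade (d : D) : 𝒜 d ≤ regrade 𝒜 δ (δ d) :=
  le_iSup (fun e : {e : D // δ e = δ d} => 𝒜 e) ⟨d, rfl⟩

lemma regrade_induction {d' : D'} {p : S → Prop} {x : S} (hx : x ∈ regrade 𝒜 δ d')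
    (mem : ∀ d, δ d = d' → ∀ a ∈ 𝒜 d, p a) (zero : p 0) (add : ∀ a b, p a → p b → p (a + b)) :
    p x :=
  AddSubgroup.iSup_induction (C := p) (fun d : {d : D // δ d = d'} => 𝒜 d) hx
    (fun d a ha => mem d.1 d.2 a ha) zero add

end Regrade

section Regrading

variable {D : Type v} [AddCommGroup D] {D' : Type w} [AddCommGroup D'] {S : Type u} [CommRing S]
variable [DecidableEq D] [DecidableEq D'] (𝒜 : D → AddSubgroup S) [GradedRing 𝒜] (δ : D →+ D')

instance : SetLike.GradedMonoid (regrade 𝒜 δ) where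
  one_mem := by
    have := le_regrade 𝒜 δ 0 SetLike.GradedOne.one_mem
    rwa [map_zero] at this
  mul_mem := by
    intro i j x y hx hy
    refine regrade_induction 𝒜 δ (p := fun x => x * y ∈ _) hx (fun d hd a ha => ?_) (by simp [zero_mem])
      (fun a b ha hb => by rw [add_mul]; exact add_mem ha hb)
    refine regrade_induction 𝒜 δ (p := fun y => a * y ∈ _) hy (fun e he b hb => ?_) (by simp [zero_mem])
      (fun a b ha hb => by rw [mul_add]; exact add_mem ha hb)
    rw [← hd, ← he, ← map_add]
    exact le_regrade 𝒜 δ _ (SetLike.mul_mem_graded ha hb)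

/-- The decomposition of an element of `S` into its components with respect to `S_δ`. -/
def regradeDecompose : S →+ DirectSum D' (fun d' => regrade 𝒜 δ d') :=
  (DirectSum.toAddMonoid fun d =>
    (DirectSum.of (fun d' => regrade 𝒜 δ d') (δ d)).comp
      (AddSubgroup.inclusion (le_regrade 𝒜 δ d))).comp
    (DirectSum.decomposeAddEquiv 𝒜 : S →+ DirectSum D (fun d => 𝒜 d))

lemma regradeDecompose_of_mem {d : D} {a : S} (ha : a ∈ 𝒜 d) :
    regradeDecompose 𝒜 δ a = DirectSum.of (fun d' => regrade 𝒜 δ d') (δ d)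
      ⟨a, le_regrade 𝒜 δ d ha⟩ := by
  change DirectSum.toAddMonoid _ (DirectSum.decompose 𝒜 a) = _
  rw [DirectSum.decompose_of_mem 𝒜 ha, DirectSum.toAddMonoid_of]
  rfl

lemma regradeDecompose_of_mem_regrade {d' : D'} {x : S} (hx : x ∈ regrade 𝒜 δ d') :
    regradeDecompose 𝒜 δ x = DirectSum.of (fun d' => regrade 𝒜 δ d') d' ⟨x, hx⟩ := by
  suffices h : ∃ h : x ∈ regrade 𝒜 δ d', regradeDecompose 𝒜 δ x =
      DirectSum.of (fun d' => regrade 𝒜 δ d') d' ⟨x, h⟩ from h.2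
  refine regrade_induction 𝒜 δ (p := fun x => ∃ h : x ∈ regrade 𝒜 δ d', regradeDecompose 𝒜 δ x =
      DirectSum.of (fun d' => regrade 𝒜 δ d') d' ⟨x, h⟩) hx ?_ ?_ ?_
  · rintro d rfl a ha
    exact ⟨le_regrade 𝒜 δ d ha, regradeDecompose_of_mem 𝒜 δ ha⟩
  · exact ⟨zero_mem _, by rw [map_zero]; exact (map_zero _).symm⟩
  · rintro a b ⟨ha, ha'⟩ ⟨hb, hb'⟩
    exact ⟨add_mem ha hb, by rw [map_add, ha', hb', ← map_add]; rfl⟩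

instance : GradedRing (regrade 𝒜 δ) where
  decompose' := regradeDecompose 𝒜 δ
  left_inv x := by
    change DirectSum.coeAddMonoidHom (regrade 𝒜 δ) (regradeDecompose 𝒜 δ x) = x
    induction x using DirectSum.Decomposition.inductionOn 𝒜 with
    | zero => simp
    | homogeneous m => simp [regradeDecompose_of_mem 𝒜 δ m.2]
    | add m m' h h' => rw [map_add, map_add, h, h']
  right_inv x := by
    change regradeDecompose 𝒜 δ (DirectSum.coeAddMonoidHom (regrade 𝒜 δ) x) = x
    induction x using DirectSum.induction_on with
    | zero => simp
    | of d' x => simp [regradeDecompose_of_mem_regrade 𝒜 δ x.2]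
    | add m m' h h' => rw [map_add, map_add, h, h']

lemma awayGrading_le_regrade (f : S) (d : D) :
    awayGrading 𝒜 f d ≤ awayGrading (regrade 𝒜 δ) f (δ d) := by
  rintro x ⟨n, e, a, hn, ha, hx⟩
  exact ⟨n, δ e, a, le_regrade 𝒜 δ e hn, by rw [← map_add]; exact le_regrade 𝒜 δ _ ha, hx⟩

/-- The inclusion `S_(f) ⊆ (S_δ)_(f)` inside `S_f`. -/
def regradeAwayZero (f : S) : AwayZero 𝒜 f →+* AwayZero (regrade 𝒜 δ) f where
  toFun x := ⟨x, by simpa using awayGrading_le_regrade 𝒜 δ f 0 x.2⟩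
  map_one' := rfl
  map_zero' := rfl
  map_mul' _ _ := rfl
  map_add' _ _ := rfl

/-- The inclusion `S_0 ⊆ (S_δ)_0` inside `S`. -/
def regradeZero : 𝒜 0 →+* regrade 𝒜 δ 0 where
  toFun x := ⟨x, by simpa using le_regrade 𝒜 δ 0 x.2⟩
  map_one' := rfl
  map_zero' := rfl
  map_mul' _ _ := rfl
  map_add' _ _ := rfl

/-- The open subscheme `U` of `Proj S_δ`: the union of the charts `Spec (S_δ)_(f)` over the
elements `f` that are relevant both for `S` and for `S_δ`. -/
def regradeDomain : (multiProj (regrade 𝒜 δ)).Opens :=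
  ⨆ f : {f : S // IsRelevant 𝒜 f ∧ IsRelevant (regrade 𝒜 δ) f},
    (chart (regrade 𝒜 δ) f.1 f.2.2).opensRange

/-- The chart `Spec (S_δ)_(f)` as an open subscheme of `U`. -/
def regradeChart (f : S) (hf : IsRelevant 𝒜 f) (hf' : IsRelevant (regrade 𝒜 δ) f) :
    Spec (.of (AwayZero (regrade 𝒜 δ) f)) ⟶ (regradeDomain 𝒜 δ).toScheme :=
  IsOpenImmersion.lift (regradeDomain 𝒜 δ).ι (chart (regrade 𝒜 δ) f hf') (by
    rw [Scheme.Opens.range_ι]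
    exact le_iSup (fun f : {f : S // IsRelevant 𝒜 f ∧ IsRelevant (regrade 𝒜 δ) f} =>
      (chart (regrade 𝒜 δ) f.1 f.2.2).opensRange) ⟨f, hf, hf'⟩)

end Regrading

end
end MultiProj

namespace MultiProj

open CategoryTheory CategoryTheory.Limits AlgebraicGeometry

/-! ### Inclusions and overlaps of the charts of `Proj S`. -/

section Proj

variable {D : Type v} [AddCommGroup D] {S : Type u} [CommRing S]
variable [DecidableEq D] (𝒜 : D → AddSubgroup S) [GradedRing 𝒜]

/-! Both gradings localize `S` to the same rings `S_f`; only the degree-zero subrings differ, and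
`S_(f) ⊆ (S_δ)_(f)` is the identity on elements. The inclusions therefore commute with all maps `S_g
→ S_f`, and the chart morphisms are compatible with shrinking charts (`chartMap_regradeChartMap`).

In `Proj S_δ` the charts of `f` and `g` meet exactly in the chart of `fg`, and `fg` is relevant for
both gradings if `f` and `g` are. Hence the chart morphisms agree on overlaps
(`pullback_fst_regradeChartMap`) and glue to `φ`. Uniqueness and compatibility over `Spec S_0` are
checked on the charts covering `U` (`regradeDomain_hom_ext`).

For density, `D_+(h)` is nonempty exactly when `h` is not nilpotent, and every nonempty open set
contains a nonempty `D_+(h)`: in `Spec S_(g)` the locus where `a / g ^ n` is invertible contains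
`D_+(ga)`. So `U` is dense iff it meets every nonempty `D_+(g)`, that is, iff some `D_+(f) ∩ D_+(g)
= D_+(fg)` with `f` relevant for both gradings is nonempty. -/

/-- The inclusion `D_+(f) ⊆ D_+(g)` for `f ≤ g`. -/
noncomputable def chartMap {f g : Rel 𝒜} (h : f ≤ g) :
    Spec (.of (AwayZero 𝒜 f.val)) ⟶ Spec (.of (AwayZero 𝒜 g.val)) :=
  Spec.map (CommRingCat.ofHom
    (awayZeroMap 𝒜 f.isRelevant.isHomogeneous g.isRelevant.isHomogeneous h))

instance {f g : Rel 𝒜} (h : f ≤ g) : IsOpenImmersion (chartMap 𝒜 h) :=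
  inferInstanceAs (IsOpenImmersion ((chartDiagram 𝒜).map (homOfLE h)))

lemma chartMap_chartMap {f g k : Rel 𝒜} (h : f ≤ g) (h' : g ≤ k) :
    chartMap 𝒜 h ≫ chartMap 𝒜 h' = chartMap 𝒜 (h.trans h') :=
  ((chartDiagram 𝒜).map_comp (homOfLE h) (homOfLE h')).symm

lemma chartMap_chart {f g : Rel 𝒜} (h : f ≤ g) :
    chartMap 𝒜 h ≫ chart 𝒜 g.val g.isRelevant = chart 𝒜 f.val f.isRelevant :=
  colimit.w (chartDiagram 𝒜) (homOfLE h)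

lemma exists_chart_eq (x : multiProj 𝒜) :
    ∃ (f : S) (hf : IsRelevant 𝒜 f) (y : Spec (.of (AwayZero 𝒜 f))), chart 𝒜 f hf y = x := by
  obtain ⟨f, y, hy⟩ := Scheme.IsLocallyDirected.ι_jointly_surjective (chartDiagram 𝒜) x
  exact ⟨f.val, f.isRelevant, y, hy⟩

/-- The charts `D_+(f)` and `D_+(g)` meet in `D_+(fg)`. -/
lemma exists_of_chart_eq_chart (f g : Rel 𝒜) (x : Spec (.of (AwayZero 𝒜 f.val)))
    (y : Spec (.of (AwayZero 𝒜 g.val)))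
    (h : chart 𝒜 f.val f.isRelevant x = chart 𝒜 g.val g.isRelevant y) :
    ∃ z, chartMap 𝒜 (Rel.mul_le_left 𝒜 f g) z = x := by
  obtain ⟨k, kf, kg, z, rfl, -⟩ :=
    (Scheme.IsLocallyDirected.ι_eq_ι_iff (chartDiagram 𝒜) (i := f) (j := g)).mp h
  -- The common refinement `k` is arbitrary, but both `f` and `g` divide powers of it, hence so does
  -- their product, and the chart of `k` factors through that of `f.mul g`.
  have hk : k ≤ f.mul g := by
    obtain ⟨n, hn⟩ := leOfHom kf
    obtain ⟨m, hm⟩ := leOfHom kg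
    exact ⟨n + m, by rw [pow_add]; exact mul_dvd_mul hn hm⟩
  exact ⟨chartMap 𝒜 hk z,
    congr($(chartMap_chartMap 𝒜 hk (Rel.mul_le_left 𝒜 f g)) z)⟩

/-! ### Nilpotency, nonempty charts and dense subsets. -/

lemma nontrivial_awayZero {f : S} (hf : ¬ IsNilpotent f) : Nontrivial (AwayZero 𝒜 f) := by
  refine ⟨0, 1, fun h => hf ?_⟩
  have h1 : algebraMap S (Localization.Away f) 1 = algebraMap S (Localization.Away f) 0 := by
    rw [map_one, map_zero]
    exact (congrArg Subtype.val h).symm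
  obtain ⟨n, hn⟩ := IsLocalization.Away.exists_of_eq f h1
  exact ⟨n, by simpa using hn⟩

/-- If `f ^ n = 0`, then the unit `f ^ n` of `S_f` is zero, so `S_f` and its subring `S_(f)` vanish.
With `nontrivial_awayZero`: `Spec S_(f)` is nonempty exactly when `f` is not nilpotent. -/
lemma not_isNilpotent_of_mem_spec {f : S} (x : Spec (.of (AwayZero 𝒜 f))) :
    ¬ IsNilpotent f := by
  rintro ⟨n, hn⟩
  have : Nontrivial (AwayZero 𝒜 f) := (PrimeSpectrum.nonempty_iff_nontrivial).mp ⟨x⟩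
  have h : IsUnit (algebraMap S (Localization.Away f) f ^ n) :=
    (IsLocalization.Away.algebraMap_isUnit f).pow n
  rw [← map_pow, hn, map_zero, isUnit_zero_iff] at h
  exact zero_ne_one (Subtype.ext h : (0 : AwayZero 𝒜 f) = 1)

variable {𝒜} in
/-- A homogeneous element that a relevant element divides is relevant. -/
lemma IsRelevant.mul_of_isHomogeneous {f g : S} (hf : IsRelevant 𝒜 f)
    (hg : SetLike.IsHomogeneousElem 𝒜 g) : IsRelevant 𝒜 (f * g) := by
  obtain ⟨⟨df, hdf⟩, hper⟩ := hf
  obtain ⟨dg, hdg⟩ := hg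
  have hfg : SetLike.IsHomogeneousElem 𝒜 (f * g) := ⟨df + dg, SetLike.mul_mem_graded hdf hdg⟩
  have h : ∃ n : ℕ, f ∣ (f * g) ^ n := ⟨1, by simp⟩
  have : (AddSubgroup.closure {d : D | ∃ u ∈ awayGrading 𝒜 f d, IsUnit u}).FiniteIndex := hper
  -- The map `S_f → S_{fg}` preserves degrees and units, so the group of unit degrees can only grow.
  refine ⟨hfg, AddSubgroup.finiteIndex_of_le (H := AddSubgroup.closure
    {d : D | ∃ u ∈ awayGrading 𝒜 f d, IsUnit u}) (AddSubgroup.closure_mono ?_)⟩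
  rintro d ⟨u, hu, hu'⟩
  exact ⟨locMap h u, locMap_mem hfg ⟨df, hdf⟩ h hu, hu'.map _⟩

/-- Inside `D_+(g)`, the nonvanishing locus of `r ∈ S_(g)` contains a chart `D_+(h)` with `h` not
nilpotent, unless `r` is nilpotent. -/
lemma Rel.exists_isUnit_awayZeroMap (g : Rel 𝒜) (r : AwayZero 𝒜 g.val) (hr : ¬ IsNilpotent r) :
    ∃ (h : Rel 𝒜) (hg : h ≤ g), ¬ IsNilpotent h.val ∧
      IsUnit (awayZeroMap 𝒜 h.isRelevant.isHomogeneous g.isRelevant.isHomogeneous hg r) := by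
  obtain ⟨⟨dg, hdg⟩, -⟩ := id g.isRelevant
  obtain ⟨n, a, ha, hra⟩ := (mem_awayGrading_iff hdg).mp r.2
  have hga := g.isRelevant.mul_of_isHomogeneous ⟨_, ha⟩
  have hle : ∃ k : ℕ, g.val ∣ (g.val * a) ^ k := ⟨1, by simp⟩
  -- Since `r = a / g ^ n`, inverting `g * a` inverts `r`.
  refine ⟨⟨g.val * a, hga⟩, hle, ?_, ?_⟩
  · rintro ⟨N, hN⟩
    refine hr ⟨N, Subtype.ext ?_⟩
    -- Substituting `a = r * g ^ n` turns `(g * a) ^ N = 0` into `g ^ (n * N + N) * r ^ N = 0` in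
    -- `S_g`, where `g` cancels.
    have hu : IsUnit (algebraMap S (Localization.Away g.val) g.val ^ (n * N + N)) :=
      (IsLocalization.Away.algebraMap_isUnit g.val).pow _
    have h1 := congrArg (algebraMap S (Localization.Away g.val)) hN
    simp only [map_mul, map_pow, ← hra, map_zero] at h1
    refine hu.mul_left_cancel ?_
    change _ * (r : Localization.Away g.val) ^ N = _ * 0
    rw [mul_zero, ← h1]
    ring
  · have hau : IsUnit (algebraMap S (Localization.Away (g.val * a)) a) :=
      (IsLocalization.Away.algebraMap_isUnit_iff (x := g.val * a)).mpr ⟨1, by simp⟩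
    have h1 := congrArg (locMap hle) hra
    simp only [map_mul, map_pow, locMap_algebraMap] at h1
    rw [← h1] at hau
    obtain ⟨v, hv⟩ := (isUnit_of_mul_isUnit_left hau).exists_right_inv
    -- An inverse in `S_{ga}` is not enough: it has to lie in the degree-zero part, which holds
    -- because the inverse of a unit of degree `0` has degree `-0`.
    have hrm := locMap_mem hga.isHomogeneous g.isRelevant.isHomogeneous hle r.2
    obtain ⟨d, hd⟩ := hga.isHomogeneous
    have hvm := inv_mem_awayGrading hd hrm hv
    rw [neg_zero] at hvm
    exact IsUnit.of_mul_eq_one ⟨v, hvm⟩ (Subtype.ext hv)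

/-- A subset of `Proj S` is dense as soon as it meets `D_+(h)` for all relevant `h` that are
not nilpotent. -/
lemma dense_of_forall_chart {U : Set (multiProj 𝒜)}
    (H : ∀ h : Rel 𝒜, ¬ IsNilpotent h.val →
      ∃ z, chart 𝒜 h.val h.isRelevant z ∈ U) : Dense U := by
  refine dense_iff_inter_open.mpr fun W hW ⟨x, hx⟩ => ?_
  obtain ⟨g, hg, y, rfl⟩ := exists_chart_eq 𝒜 x
  obtain ⟨_, ⟨_, ⟨r, rfl⟩, rfl⟩, hyr, hrW⟩ := PrimeSpectrum.isBasis_basic_opens.exists_subset_of_mem_open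
    (show y ∈ (chart 𝒜 g hg ⁻¹' W : Set (PrimeSpectrum (AwayZero 𝒜 g))) from hx)
    (hW.preimage (chart 𝒜 g hg).continuous)
  -- A nilpotent lies in every prime, but `r` does not lie in the prime `y`.
  have hr : ¬ IsNilpotent r := fun hr => hyr (nilpotent_iff_mem_prime.mp hr _ y.2)
  obtain ⟨h, hle, hnil, hunit⟩ := Rel.exists_isUnit_awayZeroMap 𝒜 ⟨g, hg⟩ r hr
  obtain ⟨z, hz⟩ := H h hnil
  refine ⟨_, ?_, hz⟩
  rw [← chartMap_chart 𝒜 hle, Scheme.Hom.comp_apply]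
  refine hrW ?_
  -- The image of `r` in `S_(h)` is a unit, so it avoids the prime `z`: all of `D_+(h)` lands in the
  -- basic open set of `r`.
  exact fun hmem => z.2.ne_top (Ideal.eq_top_of_isUnit_mem _ hmem hunit)

end Proj

/-! ### The open subscheme `U` and its charts. -/

section Regrading

variable {D : Type v} [AddCommGroup D] {D' : Type w} [AddCommGroup D'] {S : Type u} [CommRing S]
variable [DecidableEq D] [DecidableEq D'] (𝒜 : D → AddSubgroup S) [GradedRing 𝒜] (δ : D →+ D')

lemma regradeChart_ι (f : S) (hf : IsRelevant 𝒜 f) (hf' : IsRelevant (regrade 𝒜 δ) f) :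
    regradeChart 𝒜 δ f hf hf' ≫ (regradeDomain 𝒜 δ).ι = chart (regrade 𝒜 δ) f hf' :=
  IsOpenImmersion.lift_fac _ _ _

instance (f : S) (hf : IsRelevant 𝒜 f) (hf' : IsRelevant (regrade 𝒜 δ) f) :
    IsOpenImmersion (regradeChart 𝒜 δ f hf hf') := by
  have : IsOpenImmersion (regradeChart 𝒜 δ f hf hf' ≫ (regradeDomain 𝒜 δ).ι) := by
    rw [regradeChart_ι]; infer_instance
  exact IsOpenImmersion.of_comp _ (regradeDomain 𝒜 δ).ι

lemma mem_regradeDomain_iff {x : multiProj (regrade 𝒜 δ)} :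
    x ∈ regradeDomain 𝒜 δ ↔ ∃ (f : S) (_ : IsRelevant 𝒜 f) (hf' : IsRelevant (regrade 𝒜 δ) f)
      (y : Spec (.of (AwayZero (regrade 𝒜 δ) f))), chart (regrade 𝒜 δ) f hf' y = x := by
  rw [regradeDomain, TopologicalSpace.Opens.mem_iSup]
  constructor
  · rintro ⟨⟨f, hf, hf'⟩, y, hy⟩
    exact ⟨f, hf, hf', y, hy⟩
  · rintro ⟨f, hf, hf', y, hy⟩
    exact ⟨⟨f, hf, hf'⟩, y, hy⟩

/-- The cover of `U` by the charts `Spec (S_δ)_(f)`. -/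
noncomputable def regradeCover : (regradeDomain 𝒜 δ).toScheme.OpenCover :=
  Scheme.Cover.mkOfCovers {f : S // IsRelevant 𝒜 f ∧ IsRelevant (regrade 𝒜 δ) f}
    (fun f => Spec (.of (AwayZero (regrade 𝒜 δ) f.1)))
    (fun f => regradeChart 𝒜 δ f.1 f.2.1 f.2.2)
    (by
      intro x
      obtain ⟨f, hf, hf', y, hy⟩ := (mem_regradeDomain_iff 𝒜 δ).mp x.2
      refine ⟨⟨f, hf, hf'⟩, y, (regradeDomain 𝒜 δ).ι.isOpenEmbedding.injective ?_⟩
      rw [← Scheme.Hom.comp_apply, regradeChart_ι]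
      exact hy)
    (fun f => inferInstanceAs (IsOpenImmersion (regradeChart 𝒜 δ f.1 f.2.1 f.2.2)))

variable {𝒜 δ} in
lemma regradeDomain_hom_ext {Y : Scheme.{u}} {φ ψ : (regradeDomain 𝒜 δ).toScheme ⟶ Y}
    (h : ∀ (f : S) (hf : IsRelevant 𝒜 f) (hf' : IsRelevant (regrade 𝒜 δ) f),
      regradeChart 𝒜 δ f hf hf' ≫ φ = regradeChart 𝒜 δ f hf hf' ≫ ψ) : φ = ψ :=
  Scheme.Cover.hom_ext (regradeCover 𝒜 δ) _ _ fun f => h f.1 f.2.1 f.2.2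

/-! ### Gluing the chart morphisms. -/

/-- The composition `Spec (S_δ)_(f) ⟶ Spec S_(f) = D_+(f) ⊆ Proj S`. -/
noncomputable def regradeChartMap (f : S) (hf : IsRelevant 𝒜 f) :
    Spec (.of (AwayZero (regrade 𝒜 δ) f)) ⟶ multiProj 𝒜 :=
  Spec.map (CommRingCat.ofHom (regradeAwayZero 𝒜 δ f)) ≫ chart 𝒜 f hf

lemma chartMap_regradeChartMap {f g : Rel (regrade 𝒜 δ)} (h : f ≤ g)
    (hf : IsRelevant 𝒜 f.val) (hg : IsRelevant 𝒜 g.val) :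
    chartMap (regrade 𝒜 δ) h ≫ regradeChartMap 𝒜 δ g.val hg = regradeChartMap 𝒜 δ f.val hf := by
  -- The order on `Rel` is divisibility in `S`, independent of the grading, so `h` also compares `f`
  -- and `g` as relevant elements for `𝒜`.
  have h2 : Spec.map (CommRingCat.ofHom (awayZeroMap 𝒜 hf.isHomogeneous hg.isHomogeneous h)) ≫
      chart 𝒜 g.val hg = chart 𝒜 f.val hf :=
    chartMap_chart 𝒜 (f := ⟨f.val, hf⟩) (g := ⟨g.val, hg⟩) h
  have h1 : chartMap (regrade 𝒜 δ) h ≫ Spec.map (CommRingCat.ofHom (regradeAwayZero 𝒜 δ g.val)) =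
      Spec.map (CommRingCat.ofHom (regradeAwayZero 𝒜 δ f.val)) ≫
        Spec.map (CommRingCat.ofHom (awayZeroMap 𝒜 hf.isHomogeneous hg.isHomogeneous h)) := by
    rw [chartMap, ← Spec.map_comp, ← Spec.map_comp, ← CommRingCat.ofHom_comp,
      ← CommRingCat.ofHom_comp]
    rfl
  rw [regradeChartMap, regradeChartMap, reassoc_of% h1, h2]

/-- The gluing condition. The fibre product over `U` is identified with `Spec (S_δ)_(fg)`; there
both sides become the chart morphism of `fg`, which is relevant for `𝒜` as well. -/
lemma pullback_fst_regradeChartMap (f g : Rel (regrade 𝒜 δ)) (hf : IsRelevant 𝒜 f.val)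
    (hg : IsRelevant 𝒜 g.val) :
    pullback.fst (regradeChart 𝒜 δ f.val hf f.isRelevant)
        (regradeChart 𝒜 δ g.val hg g.isRelevant) ≫ regradeChartMap 𝒜 δ f.val hf =
      pullback.snd _ _ ≫ regradeChartMap 𝒜 δ g.val hg := by
  let l := chartMap (regrade 𝒜 δ) (Rel.mul_le_left _ f g)
  let r := chartMap (regrade 𝒜 δ) (Rel.mul_le_right _ f g)
  let p := pullback.fst (regradeChart 𝒜 δ f.val hf f.isRelevant)
    (regradeChart 𝒜 δ g.val hg g.isRelevant)
  let q := pullback.snd (regradeChart 𝒜 δ f.val hf f.isRelevant)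
    (regradeChart 𝒜 δ g.val hg g.isRelevant)
  have hpq : p ≫ chart (regrade 𝒜 δ) f.val f.isRelevant =
      q ≫ chart (regrade 𝒜 δ) g.val g.isRelevant := by
    rw [← regradeChart_ι 𝒜 δ f.val hf, ← regradeChart_ι 𝒜 δ g.val hg]
    exact pullback.condition_assoc _
  -- The comparison of `Spec (S_δ)_(fg)` with the fibre product; the required equality is tested in
  -- `Proj S_δ` because `U` embeds there.
  let e := pullback.lift (f := regradeChart 𝒜 δ f.val hf f.isRelevant)
    (g := regradeChart 𝒜 δ g.val hg g.isRelevant) l r (by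
      rw [← cancel_mono (regradeDomain 𝒜 δ).ι, Category.assoc, Category.assoc, regradeChart_ι,
        regradeChart_ι]
      exact (chartMap_chart _ _).trans (chartMap_chart _ _).symm)
  have hl : e ≫ p = l := pullback.lift_fst _ _ _
  have hr : e ≫ q = r := pullback.lift_snd _ _ _
  -- Both `p` and `e ≫ p = l` are open immersions, hence so is `e`; it remains to see that `e` is
  -- surjective.
  have he : IsOpenImmersion e := by
    have : IsOpenImmersion (e ≫ p) := by rw [hl]; infer_instance
    exact IsOpenImmersion.of_comp e p
  have hs : Surjective e := by
    refine ⟨fun x => ?_⟩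
    -- `p x` and `q x` are the same point of `Proj S_δ`, so `p x = l z = p (e z)` for some `z`, and
    -- `p` is injective.
    obtain ⟨z, hz⟩ := exists_of_chart_eq_chart (regrade 𝒜 δ) f g (p x) (q x) congr($hpq x)
    refine ⟨z, p.isOpenEmbedding.injective ?_⟩
    rw [← Scheme.Hom.comp_apply, hl]
    exact hz
  have : IsIso e := (isIso_iff_isOpenImmersion_and_surjective e).mpr ⟨he, hs⟩
  have hfg : IsRelevant 𝒜 (f.mul g).val := hf.mul hg
  change p ≫ _ = q ≫ _
  rw [← cancel_epi e, reassoc_of% hl, reassoc_of% hr]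
  exact (chartMap_regradeChartMap 𝒜 δ _ hfg hf).trans (chartMap_regradeChartMap 𝒜 δ _ hfg hg).symm

/-- The natural morphism `U ⟶ Proj S`. -/
noncomputable def regradeHom : (regradeDomain 𝒜 δ).toScheme ⟶ multiProj 𝒜 :=
  (regradeCover 𝒜 δ).glueMorphisms (fun f => regradeChartMap 𝒜 δ f.1 f.2.1) fun f g =>
    pullback_fst_regradeChartMap 𝒜 δ ⟨f.1, f.2.2⟩ ⟨g.1, g.2.2⟩ f.2.1 g.2.1

lemma regradeChart_regradeHom (f : S) (hf : IsRelevant 𝒜 f)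
    (hf' : IsRelevant (regrade 𝒜 δ) f) :
    regradeChart 𝒜 δ f hf hf' ≫ regradeHom 𝒜 δ = regradeChartMap 𝒜 δ f hf :=
  (regradeCover 𝒜 δ).ι_glueMorphisms _ _ ⟨f, hf, hf'⟩

lemma regradeHom_toSpecZero :
    regradeHom 𝒜 δ ≫ toSpecZero 𝒜 = (regradeDomain 𝒜 δ).ι ≫ toSpecZero (regrade 𝒜 δ) ≫
      Spec.map (CommRingCat.ofHom (regradeZero 𝒜 δ)) := by
  refine regradeDomain_hom_ext fun f hf hf' => ?_
  rw [← Category.assoc, regradeChart_regradeHom, ← Category.assoc, regradeChart_ι, ← Category.assoc,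
    chart_toSpecZero, regradeChartMap, Category.assoc, chart_toSpecZero]
  rw [← Spec.map_comp, ← Spec.map_comp, ← CommRingCat.ofHom_comp, ← CommRingCat.ofHom_comp]
  -- Both ring maps `S_0 → (S_δ)_(f)` send `a` to `a / 1`.
  rfl

/-! ### The density criterion for `U`. -/

lemma dense_regradeDomain_iff :
    Dense (regradeDomain 𝒜 δ : Set (multiProj (regrade 𝒜 δ))) ↔
      ∀ g : S, IsRelevant (regrade 𝒜 δ) g → ¬ IsNilpotent g →
        ∃ f : S, IsRelevant 𝒜 f ∧ IsRelevant (regrade 𝒜 δ) f ∧ ¬ IsNilpotent (f * g) := by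
  constructor
  · intro H g hg hnil
    have := nontrivial_awayZero (regrade 𝒜 δ) hnil
    obtain ⟨x⟩ : Nonempty (PrimeSpectrum (AwayZero (regrade 𝒜 δ) g)) := inferInstance
    -- The chart of `g` is a nonempty open set, so it meets `U`, hence some chart of an `f` relevant
    -- for both gradings. The common point lies in the chart of `fg`, so `fg` is not nilpotent.
    obtain ⟨_, ⟨y, rfl⟩, hU⟩ := H.inter_open_nonempty _
      (chart (regrade 𝒜 δ) g hg).isOpenEmbedding.isOpen_range ⟨_, x, rfl⟩
    obtain ⟨f, hf, hf', z, hz⟩ := (mem_regradeDomain_iff 𝒜 δ).mp hU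
    obtain ⟨p, -⟩ := exists_of_chart_eq_chart (regrade 𝒜 δ) ⟨f, hf'⟩ ⟨g, hg⟩ z y hz
    exact ⟨f, hf, hf', not_isNilpotent_of_mem_spec (regrade 𝒜 δ) p⟩
  · intro H
    refine dense_of_forall_chart (regrade 𝒜 δ) fun h hnil => ?_
    obtain ⟨f, hf, hf', hfh⟩ := H h.val h.isRelevant hnil
    have := nontrivial_awayZero (regrade 𝒜 δ) hfh
    obtain ⟨x⟩ : Nonempty (PrimeSpectrum (AwayZero (regrade 𝒜 δ) (f * h.val))) := inferInstance
    let F : Rel (regrade 𝒜 δ) := ⟨f, hf'⟩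
    have hw := (chartMap_chart (regrade 𝒜 δ) (Rel.mul_le_left _ F h)).trans
      (chartMap_chart (regrade 𝒜 δ) (Rel.mul_le_right _ F h)).symm
    -- A point of the nonempty chart of `f * h` lies in the chart of `h`, and also in that of `f`,
    -- hence in `U`.
    exact ⟨chartMap _ (Rel.mul_le_right _ F h) x, (mem_regradeDomain_iff 𝒜 δ).mpr
      ⟨f, hf, hf', chartMap _ (Rel.mul_le_left _ F h) x, congr($hw x)⟩⟩

end Regrading

end MultiProj

open CategoryTheory AlgebraicGeometry MultiProj in
theorem mainTheorem10 {D : Type v} {D' : Type w} [AddCommGroup D] [AddCommGroup D']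
    [AddGroup.FG D] [AddGroup.FG D'] [DecidableEq D] [DecidableEq D']
    {S : Type u} [CommRing S] (𝒜 : D → AddSubgroup S) [GradedRing 𝒜] (δ : D →+ D') :
    ∃ φ : (regradeDomain 𝒜 δ).toScheme ⟶ multiProj 𝒜,
      (∀ (f : S) (hf : IsRelevant 𝒜 f) (hf' : IsRelevant (regrade 𝒜 δ) f),
        regradeChart 𝒜 δ f hf hf' ≫ φ =
          Spec.map (CommRingCat.ofHom (regradeAwayZero 𝒜 δ f)) ≫ chart 𝒜 f hf) ∧
      (∀ ψ : (regradeDomain 𝒜 δ).toScheme ⟶ multiProj 𝒜,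
        (∀ (f : S) (hf : IsRelevant 𝒜 f) (hf' : IsRelevant (regrade 𝒜 δ) f),
          regradeChart 𝒜 δ f hf hf' ≫ ψ =
            Spec.map (CommRingCat.ofHom (regradeAwayZero 𝒜 δ f)) ≫ chart 𝒜 f hf) → ψ = φ) ∧
      φ ≫ toSpecZero 𝒜 =
        (regradeDomain 𝒜 δ).ι ≫ toSpecZero (regrade 𝒜 δ) ≫
          Spec.map (CommRingCat.ofHom (regradeZero 𝒜 δ)) ∧
      (Dense (regradeDomain 𝒜 δ : Set (multiProj (regrade 𝒜 δ))) ↔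
        ∀ g : S, IsRelevant (regrade 𝒜 δ) g → ¬ IsNilpotent g →
          ∃ f : S, IsRelevant 𝒜 f ∧ IsRelevant (regrade 𝒜 δ) f ∧ ¬ IsNilpotent (f * g)) := by
  refine ⟨regradeHom 𝒜 δ, regradeChart_regradeHom 𝒜 δ, fun ψ hψ => ?_,
    regradeHom_toSpecZero 𝒜 δ, dense_regradeDomain_iff 𝒜 δ⟩
  exact regradeDomain_hom_ext fun f hf hf' =>
    (hψ f hf hf').trans (regradeChart_regradeHom 𝒜 δ f hf hf').symm
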